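/- Let $n\ge 1$, $s\in(0,1)$, and let $\Omega\subset\mathbb R^n$ be a bounded open set (in particular, $\Omega$ may be any bounded Lipschitz domain). For a real-valued function $u$ on $\mathbb R^n$ put \[ [u]_{H^s(\mathbb R^n)}=\left(\int_{\mathbb R^n}\int_{\mathbb R^n}\frac{|u(x)-u(y)|^2}{|x-y|^{n+2s}}\,dx\,dy\right)^{1/2}, \] let $H^s(\mathbb R^n)=\{u\in L^2(\mathbb R^n): [u]_{H^s(\mathbb R^n)}<\infty\}$ and $H^s_0(\Omega)=\{u\in H^s(\mathbb R^n): u=0 \text{ a.e. on } \mathbb R^n\setminus\Omega\}$, with the norms \[ \|u\|_{H^s(\mathbb R^n)}=\left(\|u\|_{L^2(\mathbb R^n)}^2+\frac{c_{n,s}}{2}[u]_{H^s(\mathbb R^n)}^2\right)^{1/2},\qquad \|u\|_{H^s_0(\Omega)}=\left(\frac{c_{n,s}}{2}\right)^{1/2}[u]_{H^s(\mathbb R^n)}, \] where $c_{n,s}=\dfrac{s\,4^{s}\,\Gamma(n/2+s)}{\pi^{n/2}\,\Gamma(1-s)}$ is the normalising constant of the fractional Laplacian $(-\Delta)^s$.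 Then: (i) there is a constant $c>0$ such that $[u]_{H^s(\mathbb R^n)}\ge c\,\|u\|_{L^2(\Omega)}$ for every $u\in H^s_0(\Omega)$; (ii) there are constants $c,C>0$ such that $c\,\|u\|_{H^s_0(\Omega)}\le\|u\|_{H^s(\mathbb R^n)}\le C\,\|u\|_{H^s_0(\Omega)}$ for every $u\in H^s_0(\Omega)$. -/

import Mathlib

open MeasureTheory
open scoped ENNReal

namespace FracSobolev

/-- The standard normalising constant of the fractional Laplacian on `ℝⁿ`,
`c_{n,s} = s 4^s Γ(n/2 + s) / (π^{n/2} Γ(1 - s))`, for `0 < s < 1`. -/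
noncomputable def cns (n : ℕ) (s : ℝ) : ℝ :=
  s * (4 : ℝ) ^ s * Real.Gamma ((n : ℝ) / 2 + s) /
    (Real.pi ^ ((n : ℝ) / 2) * Real.Gamma (1 - s))

/-- The squared Gagliardo seminorm
`[u]² = ∫∫ |u(x) - u(y)|² / |x - y|^{n+2s} dx dy`, with values in `[0, ∞]`. -/
noncomputable def gagliardoSq {n : ℕ} (s : ℝ) (u : EuclideanSpace ℝ (Fin n) → ℝ) : ℝ≥0∞ :=
  ∫⁻ y, ∫⁻ x, ENNReal.ofReal (|u x - u y| ^ 2 / ‖x - y‖ ^ ((n : ℝ) + 2 * s))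

/-- The Gagliardo seminorm `[u]_{H^s(ℝⁿ)}`; a genuine value on functions with
`gagliardoSq s u < ∞`. -/
noncomputable def gagliardo {n : ℕ} (s : ℝ) (u : EuclideanSpace ℝ (Fin n) → ℝ) : ℝ :=
  Real.sqrt (gagliardoSq s u).toReal

/-- The fractional Sobolev space `H^s(ℝⁿ) = {u ∈ L²(ℝⁿ) : [u]² < ∞}`, as the set of all
representatives of its elements. -/
def Hs (n : ℕ) (s : ℝ) : Set (EuclideanSpace ℝ (Fin n) → ℝ) :=
  {u | MemLp u 2 volume ∧ gagliardoSq s u < ∞}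

/-- `H^s_0(Ω) = {u ∈ H^s(ℝⁿ) : u = 0 a.e. on ℝⁿ \ Ω}`. -/
def Hs0 {n : ℕ} (s : ℝ) (Ω : Set (EuclideanSpace ℝ (Fin n))) :
    Set (EuclideanSpace ℝ (Fin n) → ℝ) :=
  {u | u ∈ Hs n s ∧ ∀ᵐ x ∂volume, x ∉ Ω → u x = 0}

/-- The norm of `L²(A)`. -/
noncomputable def normL2 {n : ℕ} (A : Set (EuclideanSpace ℝ (Fin n)))
    (u : EuclideanSpace ℝ (Fin n) → ℝ) : ℝ :=
  (eLpNorm u 2 (volume.restrict A)).toReal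

/-- The full norm of `H^s(ℝⁿ)`, `(‖u‖²_{L²(ℝⁿ)} + (c_{n,s}/2) [u]²)^{1/2}`. -/
noncomputable def normHs {n : ℕ} (s : ℝ) (u : EuclideanSpace ℝ (Fin n) → ℝ) : ℝ :=
  Real.sqrt (normL2 Set.univ u ^ 2 + cns n s / 2 * gagliardo s u ^ 2)

/-- The norm of `H^s_0(Ω)`, `(c_{n,s}/2)^{1/2} [u]`. -/
noncomputable def normHs0 {n : ℕ} (s : ℝ) (u : EuclideanSpace ℝ (Fin n) → ℝ) : ℝ :=
  Real.sqrt (cns n s / 2) * gagliardo s u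

end FracSobolev

namespace FracSobolev

/-! Keep only the part of the Gagliardo integral with `x ∈ Ω` and `y` in a ball `B` disjoint from
`Ω`. There `u y = 0` and `‖x - y‖` is bounded, so this part dominates a multiple of `‖u‖²_{L²(Ω)}`.
This gives (i); (ii) follows because `u` vanishes a.e. off `Ω`. -/

theorem cns_pos {n : ℕ} {s : ℝ} (hs0 : 0 < s) (hs1 : s < 1) : 0 < cns n s := by
  have h1 : 0 < Real.Gamma ((n : ℝ) / 2 + s) := Real.Gamma_pos_of_pos (by positivity)
  have h2 : 0 < Real.Gamma (1 - s) := Real.Gamma_pos_of_pos (by linarith)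
  have := Real.pi_pos
  unfold cns
  positivity

theorem eLpNorm_two_sq {α : Type*} [MeasurableSpace α] (μ : Measure α) (u : α → ℝ) :
    eLpNorm u 2 μ ^ 2 = ∫⁻ x, ENNReal.ofReal (|u x| ^ 2) ∂μ := by
  rw [eLpNorm_eq_lintegral_rpow_enorm_toReal two_ne_zero ENNReal.ofNat_ne_top,
    ← ENNReal.rpow_natCast, ← ENNReal.rpow_mul]
  norm_num
  refine lintegral_congr fun x => ?_
  rw [← sq_abs, ENNReal.ofReal_pow (abs_nonneg _), Real.enorm_eq_ofReal_abs]

/-- If `u` vanishes a.e. on a set `B` disjoint from `A`, and the points of `A` and `B` are at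
distance at most `D`, then the Gagliardo seminorm controls the `L²` norm of `u` on `A`. -/
theorem measure_mul_eLpNorm_sq_le_gagliardoSq {n : ℕ} {s : ℝ} (hs : 0 ≤ s)
    {A B : Set (EuclideanSpace ℝ (Fin n))} (hA : MeasurableSet A) (hB : MeasurableSet B)
    (hAB : Disjoint A B) {D : ℝ} (hD : ∀ x ∈ A, ∀ y ∈ B, ‖x - y‖ ≤ D)
    {u : EuclideanSpace ℝ (Fin n) → ℝ} (hu : ∀ᵐ y ∂volume, y ∈ B → u y = 0) :
    volume B * (ENNReal.ofReal (D ^ ((n : ℝ) + 2 * s))⁻¹ *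
      eLpNorm u 2 (volume.restrict A) ^ 2) ≤ gagliardoSq s u := by
  rw [eLpNorm_two_sq, ← lintegral_const_mul' _ _ ENNReal.ofReal_ne_top, mul_comm,
    ← setLIntegral_const]
  refine le_trans ?_ (setLIntegral_le_lintegral B _)
  refine setLIntegral_mono_ae' hB ?_
  filter_upwards [hu] with y huy hy
  refine le_trans ?_ (setLIntegral_le_lintegral A _)
  refine setLIntegral_mono' hA fun x hx => ?_
  rw [huy hy, sub_zero, ← ENNReal.ofReal_mul' (by positivity)]
  refine ENNReal.ofReal_le_ofReal ?_
  -- Disjointness excludes `x = y`, where the quotient would be `0` by convention and the bound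
  -- could fail.
  have hxy : 0 < ‖x - y‖ := norm_sub_pos_iff.2 (hAB.ne_of_mem hx hy)
  rw [inv_mul_eq_div]
  have := hD x hx y hy
  gcongr

theorem gagliardo_nonneg {n : ℕ} (s : ℝ) (u : EuclideanSpace ℝ (Fin n) → ℝ) :
    0 ≤ gagliardo s u := Real.sqrt_nonneg _

theorem gagliardo_sq {n : ℕ} (s : ℝ) (u : EuclideanSpace ℝ (Fin n) → ℝ) :
    gagliardo s u ^ 2 = (gagliardoSq s u).toReal := Real.sq_sqrt ENNReal.toReal_nonneg

theorem normL2_nonneg {n : ℕ} (A : Set (EuclideanSpace ℝ (Fin n)))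
    (u : EuclideanSpace ℝ (Fin n) → ℝ) : 0 ≤ normL2 A u := ENNReal.toReal_nonneg

/-- Fractional Poincaré inequality on bounded measurable sets. -/
theorem exists_mul_normL2_le_gagliardo {n : ℕ} (hn : 1 ≤ n) {s : ℝ} (hs : 0 ≤ s)
    {Ω : Set (EuclideanSpace ℝ (Fin n))} (hΩ : MeasurableSet Ω) (hΩb : Bornology.IsBounded Ω) :
    ∃ c : ℝ, 0 < c ∧ ∀ u ∈ Hs0 s Ω, c * normL2 Ω u ≤ gagliardo s u := by
  have : Nonempty (Fin n) := ⟨⟨0, hn⟩⟩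
  obtain ⟨R, hR, hΩR⟩ := hΩb.subset_ball_lt 0 0
  -- A centre at norm `2 * R` makes the `R`-ball around it miss `ball 0 R ⊇ Ω`; distances are then
  -- at most `R + 2R + R`.
  obtain ⟨p, hp⟩ :=
    exists_norm_eq (EuclideanSpace ℝ (Fin n)) (c := 2 * R) (by positivity)
  set B := Metric.ball p R
  have hdisj : Disjoint Ω B := by
    refine Disjoint.mono_left hΩR (Metric.ball_disjoint_ball ?_)
    rw [dist_zero_left, hp, two_mul]
  have hdist : ∀ x ∈ Ω, ∀ y ∈ B, ‖x - y‖ ≤ 4 * R := by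
    intro x hx y hy
    have h1 := mem_ball_zero_iff.1 (hΩR hx)
    have h2 := mem_ball_iff_norm.1 hy
    calc ‖x - y‖ = ‖x - p - (y - p)‖ := by rw [sub_sub_sub_cancel_right]
      _ ≤ ‖x‖ + ‖p‖ + ‖y - p‖ := (norm_sub_le _ _).trans (by gcongr; exact norm_sub_le _ _)
      _ ≤ 4 * R := by linarith
  have hBpos : 0 < (volume B).toReal :=
    ENNReal.toReal_pos (Metric.measure_ball_pos _ _ hR).ne' measure_ball_lt_top.ne
  have hk : 0 < (volume B).toReal * ((4 * R) ^ ((n : ℝ) + 2 * s))⁻¹ := by positivity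
  refine ⟨√_, Real.sqrt_pos.2 hk, fun u hu => ?_⟩
  refine le_of_sq_le_sq ?_ (gagliardo_nonneg s u)
  rw [mul_pow, Real.sq_sqrt hk.le, gagliardo_sq]
  -- Finiteness of the seminorm is essential: `toReal` sends `∞` to `0`.
  have key := ENNReal.toReal_mono hu.1.2.ne <|
    measure_mul_eLpNorm_sq_le_gagliardoSq hs hΩ measurableSet_ball hdisj hdist
      (hu.2.mono fun y hy hyB => hy fun hyΩ => hdisj.ne_of_mem hyΩ hyB rfl)
  rwa [ENNReal.toReal_mul, ENNReal.toReal_mul, ENNReal.toReal_ofReal (by positivity),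
    ENNReal.toReal_pow, ← mul_assoc] at key

theorem normL2_univ_eq {n : ℕ} {s : ℝ} {Ω : Set (EuclideanSpace ℝ (Fin n))}
    (hΩ : MeasurableSet Ω) {u : EuclideanSpace ℝ (Fin n) → ℝ} (hu : u ∈ Hs0 s Ω) :
    normL2 Set.univ u = normL2 Ω u := by
  have h : u =ᵐ[volume] Ω.indicator u := by
    filter_upwards [hu.2] with x hx
    by_cases hxΩ : x ∈ Ω
    · rw [Set.indicator_of_mem hxΩ]
    · rw [Set.indicator_of_notMem hxΩ, hx hxΩ]
  rw [normL2, normL2, Measure.restrict_univ, eLpNorm_congr_ae h,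
    eLpNorm_indicator_eq_eLpNorm_restrict hΩ]

theorem normHs0_le_normHs {n : ℕ} {s : ℝ} (hc : 0 ≤ cns n s)
    (u : EuclideanSpace ℝ (Fin n) → ℝ) : normHs0 s u ≤ normHs s u := by
  refine Real.le_sqrt_of_sq_le ?_
  rw [normHs0, mul_pow, Real.sq_sqrt (by positivity)]
  exact le_add_of_nonneg_left (sq_nonneg _)

/-- The constant comes from `‖u‖² ≤ [u]² / c² = 2 / (c² c_{n,s}) · (c_{n,s}/2) [u]²`; the `+ 1` is
the seminorm term itself. -/
theorem normHs_le_of_mul_normL2_le {n : ℕ} {s : ℝ} (hC : 0 < cns n s) {c : ℝ} (hc : 0 < c)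
    {u : EuclideanSpace ℝ (Fin n) → ℝ} (hu : c * normL2 Set.univ u ≤ gagliardo s u) :
    normHs s u ≤ √(2 / (c ^ 2 * cns n s) + 1) * normHs0 s u := by
  have h := pow_le_pow_left₀ (mul_nonneg hc.le (normL2_nonneg _ u)) hu 2
  rw [mul_pow, ← le_div_iff₀' (by positivity)] at h
  refine Real.sqrt_le_iff.2
    ⟨mul_nonneg (Real.sqrt_nonneg _) (mul_nonneg (Real.sqrt_nonneg _) (gagliardo_nonneg s u)), ?_⟩
  rw [mul_pow, normHs0, mul_pow, Real.sq_sqrt (by positivity), Real.sq_sqrt (by positivity)]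
  refine (add_le_add_left h _).trans_eq ?_
  field_simp

end FracSobolev

theorem mainTheorem9 (n : ℕ) (hn : 1 ≤ n) (s : ℝ) (hs0 : 0 < s) (hs1 : s < 1)
    (Ω : Set (EuclideanSpace ℝ (Fin n))) (hΩo : IsOpen Ω) (hΩb : Bornology.IsBounded Ω) :
    (∃ c : ℝ, 0 < c ∧ ∀ u ∈ FracSobolev.Hs0 s Ω,
      c * FracSobolev.normL2 Ω u ≤ FracSobolev.gagliardo s u) ∧
    (∃ c C : ℝ, 0 < c ∧ 0 < C ∧ ∀ u ∈ FracSobolev.Hs0 s Ω,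
      c * FracSobolev.normHs0 s u ≤ FracSobolev.normHs s u ∧
      FracSobolev.normHs s u ≤ C * FracSobolev.normHs0 s u) := by
  have hΩ := hΩo.measurableSet
  have hC := FracSobolev.cns_pos (n := n) hs0 hs1
  obtain ⟨c, hc, h⟩ := FracSobolev.exists_mul_normL2_le_gagliardo hn hs0.le hΩ hΩb
  refine ⟨⟨c, hc, h⟩, 1, √(2 / (c ^ 2 * FracSobolev.cns n s) + 1), one_pos, by positivity,
    fun u hu => ⟨?_, ?_⟩⟩
  · rw [one_mul]
    exact FracSobolev.normHs0_le_normHs hC.le u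
  · refine FracSobolev.normHs_le_of_mul_normL2_le hC hc ?_
    rw [FracSobolev.normL2_univ_eq hΩ hu]
    exact h u hu
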